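/- Let $L$ be a frame, with pseudocomplement $a^{\ast}=\bigvee\{b\in L\mid a\wedge b=0\}$. Write $a\prec b$ if $a^\ast\vee b=1$, and $b\prec\!\!\prec a$ if there is a family $\{c_r\mid r\in\mathbb{Q}\cap[0,1]\}\subseteq L$ with $b\le c_0$, $c_1\le a$ and $c_r\prec c_s$ whenever $r<s$. The frame $L$ is *completely regular* if $a=\bigvee\{b\in L\mid b\prec\!\!\prec a\}$ for every $a\in L$, and *extremally disconnected* if $a^{\ast}\vee a^{\ast\ast}=1$ for every $a\in L$. Let $\mathfrak{L}(\overline{\mathbb{IR}})$ be the frame presented by generators $(r,-)$ and $(-,s)$, for $r,s\in\mathbb{Q}$, subject to the relations - $(r,-)\wedge(-,s)=0$ whenever $r\ge s$, - $(r,-)=\bigvee_{p>r}(p,-)$ for every $r\in\mathbb{Q}$, - $(-,s)=\bigvee_{q<s}(-,q)$ for every $s\in\mathbb{Q}$. Let $\overline{\mathrm{IC}}(L)$ be the set of all frame homomorphisms $f\colon\mathfrak{L}(\overline{\mathbb{IR}})\to L$, partially ordered by $f\le g$ iff $f(r,-)\le g(r,-)$ and $g(-,s)\le f(-,s)$ for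 all $r,s\in\mathbb{Q}$. Let $\overline{\mathrm{C}}(L)$ (the extended continuous real functions on $L$) be the subset of those $f\in\overline{\mathrm{IC}}(L)$ with $f(r,-)\vee f(-,s)=1$ for all $r<s$ in $\mathbb{Q}$, and let $\overline{\mathrm{H}}(L)$ (the Hausdorff continuous functions) be the subset of those $f\in\overline{\mathrm{IC}}(L)$ with $f(r,-)^\ast\le f(-,s)$ and $f(-,s)^\ast\le f(r,-)$ for all $r<s$ in $\mathbb{Q}$. **Proposition.** For every completely regular frame $L$, the following are equivalent: 1. $L$ is extremally disconnected. 2. $\overline{\mathrm{C}}(L)=\overline{\mathrm{H}}(L)$. 3. $\overline{\mathrm{C}}(L)$, with the order induced from $\overline{\mathrm{IC}}(L)$, is a complete lattice (every subset has a supremum and an infimum in $\overline{\mathrm{C}}(L)$). -/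

import Mathlib

namespace PointfreeReals

/-! ### Properties of frames -/

/-- `a` is rather below `b`: `a* ∨ b = 1`. -/
def RatherBelow {L : Type*} [Order.Frame L] (a b : L) : Prop :=
  aᶜ ⊔ b = ⊤

/-- `b` is completely below `a`: there is a family `c_r`, indexed by the rationals of `[0,1]`, with
`b ≤ c_0`, `c_1 ≤ a` and `c_r` rather below `c_s` whenever `r < s`. -/
def CompletelyBelow {L : Type*} [Order.Frame L] (b a : L) : Prop :=
  ∃ c : Set.Icc (0 : ℚ) 1 → L, b ≤ c 0 ∧ c 1 ≤ a ∧ ∀ r s, r < s → RatherBelow (c r) (c s)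

/-- A frame is completely regular if each element is the join of the elements completely below
it. -/
def IsCompletelyRegular (L : Type*) [Order.Frame L] : Prop :=
  ∀ a : L, a = sSup {b : L | CompletelyBelow b a}

/-- A frame is extremally disconnected if `a* ∨ a** = 1` for every `a`. -/
def IsExtremallyDisconnected (L : Type*) [Order.Frame L] : Prop :=
  ∀ a : L, aᶜ ⊔ aᶜᶜ = ⊤

/-- A partially ordered set is complete if every subset has a supremum and an infimum. -/
def IsCompletePoset (P : Type*) [PartialOrder P] : Prop :=
  ∀ S : Set P, (∃ a, IsLUB S a) ∧ ∃ b, IsGLB S b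

/-! ### Frames presented by generators and relations -/

/-- The free frame on `X`: the frame of lower sets of the free meet-semilattice on `X`, which
consists of the finite subsets of `X` ordered by reverse inclusion. -/
abbrev FreeFrame (X : Type*) : Type _ := LowerSet (Finset X)ᵒᵈ

/-- The generators of the free frame. -/
def FreeFrame.of {X : Type*} (x : X) : FreeFrame X :=
  LowerSet.Iic (OrderDual.toDual {x})

/-- The quotient of a frame `F` by the relations `u = v` for `(u, v) ∈ R`, realized as the largest
sublocale of `F` on which all these relations hold. -/
def quotientFrame {F : Type*} [Order.Frame F] (R : Set (F × F)) : Sublocale F where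
  carrier := {I | ∀ p ∈ R, p.1 ⇨ I = p.2 ⇨ I}
  sInf_mem' s hs p hp := by
    apply eq_of_forall_le_iff
    intro c
    have key : ∀ I ∈ s, (c ⊓ p.1 ≤ I ↔ c ⊓ p.2 ≤ I) := fun I hI => by
      rw [← le_himp_iff, ← le_himp_iff, hs hI p hp]
    simp only [le_himp_iff, le_sInf_iff]
    exact forall₂_congr key
  himp_mem' a b hb p hp := by
    rw [himp_left_comm, hb p hp, himp_left_comm]

/-- The two members of a relation become equal in the quotient. -/
theorem restrict_eq_of_mem {F : Type*} [Order.Frame F] {R : Set (F × F)} {p : F × F}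
    (hp : p ∈ R) : (quotientFrame R).restrict p.1 = (quotientFrame R).restrict p.2 := by
  apply eq_of_forall_ge_iff
  intro s
  rw [(quotientFrame R).giRestrict.gc.le_iff_le, (quotientFrame R).giRestrict.gc.le_iff_le,
    ← himp_eq_top_iff, ← himp_eq_top_iff, s.2 p hp]

/-- Every element of the free frame is a join of finite meets of generators. -/
theorem FreeFrame.eq_iSup {X : Type*} (I : FreeFrame X) :
    I = ⨆ A ∈ {A : Finset X | OrderDual.toDual A ∈ I}, A.inf FreeFrame.of := by
  have hmem : ∀ (A : Finset X) (B : (Finset X)ᵒᵈ),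
      B ∈ A.inf (FreeFrame.of (X := X)) ↔ A ⊆ OrderDual.ofDual B := by
    classical
    intro A B
    induction A using Finset.induction_on with
    | empty => simp
    | insert a A _ ih =>
      rw [Finset.inf_insert, LowerSet.mem_inf_iff, ih, Finset.insert_subset_iff]
      refine and_congr_left fun _ => ?_
      change B ≤ OrderDual.toDual {a} ↔ _
      rw [OrderDual.le_toDual]
      simp
  ext B
  simp only [SetLike.mem_coe, LowerSet.mem_iSup_iff, hmem, Set.mem_ofPred_eq]
  constructor
  · intro hB
    exact ⟨OrderDual.ofDual B, hB, subset_rfl⟩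
  · rintro ⟨A, hA, hAB⟩
    exact I.lower (show B ≤ OrderDual.toDual A from hAB) hA

/-! ### The frame of extended partial reals -/

/-- The generators `(r, —)` and `(—, s)`, for rational `r` and `s`. -/
inductive Gen : Type
  | above (r : ℚ) : Gen
  | below (s : ℚ) : Gen

open FreeFrame in
/-- The defining relations of the frame of extended partial reals:
`(r, —) ∧ (—, s) = 0` whenever `s ≤ r`; `(r, —) = ⋁_{p > r} (p, —)`; and
`(—, s) = ⋁_{q < s} (—, q)`. -/
inductive Rel : FreeFrame Gen × FreeFrame Gen → Prop
  | disjoint (r s : ℚ) (h : s ≤ r) : Rel (of (.above r) ⊓ of (.below s), ⊥)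
  | above (r : ℚ) : Rel (of (.above r), ⨆ p : {p : ℚ // r < p}, of (.above p))
  | below (s : ℚ) : Rel (of (.below s), ⨆ q : {q : ℚ // q < s}, of (.below q))

/-- The frame of extended partial reals. -/
abbrev ExtPartialReals : Type := quotientFrame {p | Rel p}

/-- The generator `(r, —)` of the frame of extended partial reals. -/
noncomputable def genAbove (r : ℚ) : ExtPartialReals :=
  (quotientFrame {p | Rel p}).restrict (FreeFrame.of (.above r))

/-- The generator `(—, s)` of the frame of extended partial reals. -/
noncomputable def genBelow (s : ℚ) : ExtPartialReals :=
  (quotientFrame {p | Rel p}).restrict (FreeFrame.of (.below s))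

theorem genAbove_inf_genBelow {r s : ℚ} (h : s ≤ r) : genAbove r ⊓ genBelow s = ⊥ := by
  have := restrict_eq_of_mem (R := {p | Rel p}) (Rel.disjoint r s h)
  rwa [map_inf, map_bot] at this

theorem genAbove_eq_iSup (r : ℚ) : genAbove r = ⨆ p : {p : ℚ // r < p}, genAbove p := by
  have := restrict_eq_of_mem (R := {p | Rel p}) (Rel.above r)
  rwa [map_iSup] at this

theorem genBelow_eq_iSup (s : ℚ) : genBelow s = ⨆ q : {q : ℚ // q < s}, genBelow q := by
  have := restrict_eq_of_mem (R := {p | Rel p}) (Rel.below s)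
  rwa [map_iSup] at this

/-! ### Extended real functions on a frame -/

/-- A continuous extended partial real function on `L`: a frame homomorphism from the frame of
extended partial reals to `L`. -/
@[ext] structure ExtPartialFun (L : Type*) [Order.Frame L] where
  toHom : FrameHom ExtPartialReals L

namespace ExtPartialFun

variable {L : Type*} [Order.Frame L]

/-- The value `f(r, —)`. -/
noncomputable def above (f : ExtPartialFun L) (r : ℚ) : L := f.toHom (genAbove r)

/-- The value `f(—, s)`. -/
noncomputable def below (f : ExtPartialFun L) (s : ℚ) : L := f.toHom (genBelow s)

/-- A continuous extended partial real function is determined by its values on generators. -/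
theorem ext_gen {f g : ExtPartialFun L} (h₁ : ∀ r, f.above r = g.above r)
    (h₂ : ∀ s, f.below s = g.below s) : f = g := by
  refine ExtPartialFun.ext (DFunLike.ext _ _ fun x => ?_)
  have hx : x = (quotientFrame {p | Rel p}).restrict x.1 := by simp
  have hgen : ∀ a : Gen, f.toHom ((quotientFrame {p | Rel p}).restrict (FreeFrame.of a)) =
      g.toHom ((quotientFrame {p | Rel p}).restrict (FreeFrame.of a)) := by
    rintro (r | s)
    · exact h₁ r
    · exact h₂ s
  rw [hx, FreeFrame.eq_iSup x.1]
  simp only [map_iSup, map_finset_inf, Function.comp_def, hgen]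

/-- The order `f ≤ g` iff `f(r, —) ≤ g(r, —)` for all `r` and `g(—, s) ≤ f(—, s)` for all `s`. -/
instance : PartialOrder (ExtPartialFun L) where
  le f g := (∀ r, f.above r ≤ g.above r) ∧ ∀ s, g.below s ≤ f.below s
  le_refl _ := ⟨fun _ => le_rfl, fun _ => le_rfl⟩
  le_trans _ _ _ h h' := ⟨fun r => (h.1 r).trans (h'.1 r), fun s => (h'.2 s).trans (h.2 s)⟩
  le_antisymm _ _ h h' :=
    ext_gen (fun r => le_antisymm (h.1 r) (h'.1 r)) (fun s => le_antisymm (h'.2 s) (h.2 s))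

end ExtPartialFun

/-- The extended continuous real functions on `L`, as those continuous extended partial real
functions that satisfy `f(r, —) ∨ f(—, s) = 1` whenever `r < s`. -/
def extContinuous (L : Type*) [Order.Frame L] : Set (ExtPartialFun L) :=
  {f | ∀ r s : ℚ, r < s → f.above r ⊔ f.below s = ⊤}

/-- The Hausdorff continuous extended partial real functions on `L`. -/
def extHausdorff (L : Type*) [Order.Frame L] : Set (ExtPartialFun L) :=
  {f | ∀ r s : ℚ, r < s → (f.above r)ᶜ ≤ f.below s ∧ (f.below s)ᶜ ≤ f.above r}

end PointfreeReals

namespace PointfreeReals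

/-! ### Frame homomorphisms out of a presented frame -/

section Presentation

variable {X L : Type*} [Order.Frame L]

/-- The right adjoint of the extension of `φ : X → L` to the free frame. -/
def FreeFrame.liftAdjoint (φ : X → L) (b : L) : FreeFrame X where
  carrier := {A | (OrderDual.ofDual A).inf φ ≤ b}
  lower' := fun A B h hA =>
    (Finset.inf_mono (show OrderDual.ofDual A ⊆ OrderDual.ofDual B from h)).trans hA

/-- The extension of `φ : X → L` to the free frame, as a function. -/
def FreeFrame.liftFun (φ : X → L) (I : FreeFrame X) : L :=
  ⨆ A ∈ {A : Finset X | OrderDual.toDual A ∈ I}, A.inf φ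

theorem FreeFrame.gc_liftFun (φ : X → L) :
    GaloisConnection (FreeFrame.liftFun φ) (FreeFrame.liftAdjoint φ) := by
  intro I b
  simp only [FreeFrame.liftFun, iSup_le_iff]
  exact Iff.rfl

theorem FreeFrame.inf_le_liftFun (φ : X → L) {I : FreeFrame X} {A : Finset X}
    (hA : OrderDual.toDual A ∈ I) : A.inf φ ≤ FreeFrame.liftFun φ I :=
  le_iSup₂_of_le A hA le_rfl

/-- The extension of `φ : X → L` to a frame homomorphism on the free frame. -/
def FreeFrame.lift (φ : X → L) : FrameHom (FreeFrame X) L where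
  toFun := FreeFrame.liftFun φ
  map_inf' I J := by
    classical
    refine le_antisymm ((FreeFrame.gc_liftFun φ).monotone_l.map_inf_le I J) ?_
    rw [FreeFrame.liftFun, FreeFrame.liftFun, biSup_inf_biSup]
    refine iSup₂_le fun p hp => ?_
    rw [← Finset.inf_union]
    refine FreeFrame.inf_le_liftFun φ (LowerSet.mem_inf_iff.2 ⟨?_, ?_⟩)
    · exact I.lower (show p.1 ⊆ p.1 ∪ p.2 from Finset.subset_union_left) hp.1
    · exact J.lower (show p.2 ⊆ p.1 ∪ p.2 from Finset.subset_union_right) hp.2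
  map_top' := top_le_iff.1 (FreeFrame.inf_le_liftFun φ (A := ∅) (LowerSet.mem_top))
  map_sSup' s := by rw [(FreeFrame.gc_liftFun φ).l_sSup, sSup_image]

theorem FreeFrame.gc_lift (φ : X → L) :
    GaloisConnection (FreeFrame.lift φ) (FreeFrame.liftAdjoint φ) :=
  FreeFrame.gc_liftFun φ

@[simp]
theorem FreeFrame.lift_of (φ : X → L) (x : X) : FreeFrame.lift φ (FreeFrame.of x) = φ x := by
  refine le_antisymm (((FreeFrame.gc_lift φ) _ _).2 fun A hA => ?_) ?_
  · exact Finset.inf_le (Finset.singleton_subset_iff.1 (show {x} ⊆ OrderDual.ofDual A from hA))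
  · exact Finset.inf_singleton.ge.trans
      (FreeFrame.inf_le_liftFun φ (A := {x}) (LowerSet.mem_Iic_iff.2 le_rfl))

variable {F : Type*} [Order.Frame F] {R : Set (F × F)}

theorem adjoint_mem_quotientFrame {h : FrameHom F L} {g : L → F} (gc : GaloisConnection h g)
    (hR : ∀ p ∈ R, h p.1 = h p.2) (b : L) : g b ∈ quotientFrame R := by
  intro p hp
  apply eq_of_forall_le_iff
  intro c
  rw [le_himp_iff, le_himp_iff, ← gc.le_iff_le, ← gc.le_iff_le, map_inf, map_inf, hR p hp]

theorem map_restrict_quotientFrame {h : FrameHom F L} {g : L → F} (gc : GaloisConnection h g)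
    (hR : ∀ p ∈ R, h p.1 = h p.2) (x : F) : h ((quotientFrame R).restrict x).1 = h x := by
  apply eq_of_forall_ge_iff
  intro b
  have := (quotientFrame R).giRestrict.gc x ⟨g b, adjoint_mem_quotientFrame gc hR b⟩
  rw [gc.le_iff_le, gc.le_iff_le]
  exact this

/-- A frame homomorphism with a right adjoint that identifies the members of each relation
factors through the quotient. -/
def quotientLift (h : FrameHom F L) (g : L → F) (gc : GaloisConnection h g)
    (hR : ∀ p ∈ R, h p.1 = h p.2) : FrameHom (quotientFrame R) L where
  toFun x := h x.1
  map_inf' x y := map_inf h x.1 y.1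
  map_top' := map_top h
  map_sSup' s := by
    have hs : sSup s = (quotientFrame R).restrict (sSup (Subtype.val '' s)) := by
      rw [map_sSup, Set.image_image]
      simp
    rw [hs, map_restrict_quotientFrame gc hR, map_sSup, Set.image_image]

end Presentation

/-! ### Construction of extended partial real functions -/

namespace ExtPartialFun

variable {L : Type*} [Order.Frame L]

theorem above_inf_below (f : ExtPartialFun L) {r s : ℚ} (h : s ≤ r) :
    f.above r ⊓ f.below s = ⊥ := by
  rw [above, below, ← map_inf, genAbove_inf_genBelow h, map_bot]

theorem above_eq_iSup (f : ExtPartialFun L) (r : ℚ) :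
    f.above r = ⨆ p : {p : ℚ // r < p}, f.above p := by
  rw [above, genAbove_eq_iSup, map_iSup]
  rfl

theorem antitone_above (f : ExtPartialFun L) : Antitone f.above :=
  antitone_iff_forall_lt.2 fun p q h => by
    rw [f.above_eq_iSup p]
    exact le_iSup_of_le ⟨q, h⟩ le_rfl

theorem below_eq_iSup (f : ExtPartialFun L) (s : ℚ) :
    f.below s = ⨆ q : {q : ℚ // q < s}, f.below q := by
  rw [below, genBelow_eq_iSup, map_iSup]
  rfl

theorem below_le_compl_above (f : ExtPartialFun L) (r : ℚ) : f.below r ≤ (f.above r)ᶜ :=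
  le_compl_iff_disjoint_left.2 (disjoint_iff.2 (f.above_inf_below le_rfl))

/-- There is an extended partial real function with prescribed values on generators, as soon as
these satisfy the defining relations. -/
theorem exists_of_gen (u v : ℚ → L) (huv : ∀ r s, s ≤ r → u r ⊓ v s = ⊥)
    (hu : ∀ r, u r = ⨆ p : {p : ℚ // r < p}, u p)
    (hv : ∀ s, v s = ⨆ q : {q : ℚ // q < s}, v q) :
    ∃ f : ExtPartialFun L, (∀ r, f.above r = u r) ∧ ∀ s, f.below s = v s := by
  let φ : Gen → L := fun x => Gen.casesOn x u v
  have hR : ∀ p ∈ {p | Rel p}, FreeFrame.lift φ p.1 = FreeFrame.lift φ p.2 := by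
    rintro _ (⟨r, s, h⟩ | r | s)
    · simpa [φ] using huv r s h
    · simpa [φ] using hu r
    · simpa [φ] using hv s
  refine ⟨⟨quotientLift (FreeFrame.lift φ) _ (FreeFrame.gc_lift φ) hR⟩, fun r => ?_, fun s => ?_⟩
  · exact (map_restrict_quotientFrame (FreeFrame.gc_lift φ) hR _).trans (FreeFrame.lift_of φ _)
  · exact (map_restrict_quotientFrame (FreeFrame.gc_lift φ) hR _).trans (FreeFrame.lift_of φ _)

/-- A scale: a family `c` indexed by the rationals such that `c q` is rather below `c p` for
`p < q`. -/
def IsScale (c : ℚ → L) : Prop :=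
  ∀ p q, p < q → RatherBelow (c q) (c p)

theorem _root_.PointfreeReals.RatherBelow.le {a b : L} (h : RatherBelow a b) : a ≤ b := by
  have : a ⊓ (aᶜ ⊔ b) ≤ b := by
    rw [inf_sup_left, inf_compl_self, bot_sup_eq]
    exact inf_le_right
  rwa [h, inf_top_eq] at this

theorem _root_.PointfreeReals.RatherBelow.compl {a b : L} (h : RatherBelow a b) :
    RatherBelow bᶜ aᶜ := by
  rw [RatherBelow, sup_comm, ← top_le_iff, ← h]
  exact sup_le_sup_left le_compl_compl _

theorem IsScale.antitone {c : ℚ → L} (hc : IsScale c) : Antitone c :=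
  antitone_iff_forall_lt.2 fun p q h => (hc p q h).le

theorem iSup_gt_eq (c : ℚ → L) (r : ℚ) :
    ⨆ p : {p : ℚ // r < p}, c p =
      ⨆ p : {p : ℚ // r < p}, ⨆ q : {q : ℚ // (p : ℚ) < q}, c q := by
  refine le_antisymm (iSup_le fun p => ?_)
    (iSup_le fun p => iSup_le fun q => le_iSup_of_le ⟨q, p.2.trans q.2⟩ le_rfl)
  obtain ⟨t, h₁, h₂⟩ := exists_between p.2
  exact le_iSup_of_le ⟨t, h₁⟩ (le_iSup_of_le ⟨p, h₂⟩ le_rfl)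

theorem iSup_lt_eq (c : ℚ → L) (r : ℚ) :
    ⨆ p : {p : ℚ // p < r}, c p =
      ⨆ p : {p : ℚ // p < r}, ⨆ q : {q : ℚ // q < (p : ℚ)}, c q := by
  refine le_antisymm (iSup_le fun p => ?_)
    (iSup_le fun p => iSup_le fun q => le_iSup_of_le ⟨q, q.2.trans p.2⟩ le_rfl)
  obtain ⟨t, h₁, h₂⟩ := exists_between p.2
  exact le_iSup_of_le ⟨t, h₂⟩ (le_iSup_of_le ⟨p, h₁⟩ le_rfl)

/-- A scale generates an extended continuous real function. -/
theorem IsScale.exists_extContinuous {c : ℚ → L} (hc : IsScale c) :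
    ∃ f ∈ extContinuous L, (∀ r, f.above r = ⨆ p : {p : ℚ // r < p}, c p) ∧
      ∀ s, f.below s = ⨆ q : {q : ℚ // q < s}, (c q)ᶜ := by
  have huv (r s : ℚ) (h : s ≤ r) :
      (⨆ p : {p : ℚ // r < p}, c p) ⊓ (⨆ q : {q : ℚ // q < s}, (c q)ᶜ) = ⊥ := by
    rw [← disjoint_iff, iSup_disjoint_iff]
    intro p
    rw [disjoint_iSup_iff]
    intro q
    exact (hc.antitone ((q.2.trans_le h).trans p.2).le).disjoint_compl_right
  obtain ⟨f, hu, hv⟩ := exists_of_gen (fun r => ⨆ p : {p : ℚ // r < p}, c p)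
    (fun s => ⨆ q : {q : ℚ // q < s}, (c q)ᶜ) huv (iSup_gt_eq c) (iSup_lt_eq fun q => (c q)ᶜ)
  refine ⟨f, fun r s h => ?_, hu, hv⟩
  obtain ⟨p, hrp, hps⟩ := exists_between h
  obtain ⟨q, hpq, hqs⟩ := exists_between hps
  rw [← top_le_iff, ← hc p q hpq, hu, hv, sup_comm]
  exact sup_le_sup (le_iSup_of_le ⟨p, hrp⟩ le_rfl) (le_iSup_of_le ⟨q, hqs⟩ le_rfl)

end ExtPartialFun

open ExtPartialFun

variable {L : Type*} [Order.Frame L]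

theorem compl_above_le_below {f : ExtPartialFun L} (hf : f ∈ extContinuous L) {r s : ℚ}
    (h : r < s) : (f.above r)ᶜ ≤ f.below s := by
  have h' : (f.above r)ᶜ ⊓ (f.above r ⊔ f.below s) ≤ f.below s := by
    rw [inf_sup_left, compl_inf_self, bot_sup_eq]
    exact inf_le_right
  rwa [hf r s h, inf_top_eq] at h'

theorem compl_below_le_above {f : ExtPartialFun L} (hf : f ∈ extContinuous L) {r s : ℚ}
    (h : r < s) : (f.below s)ᶜ ≤ f.above r := by
  have h' : (f.below s)ᶜ ⊓ (f.above r ⊔ f.below s) ≤ f.above r := by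
    rw [inf_sup_left, compl_inf_self, sup_bot_eq]
    exact inf_le_right
  rwa [hf r s h, inf_top_eq] at h'

theorem extContinuous_subset_extHausdorff : extContinuous L ⊆ extHausdorff L :=
  fun _ hf _ _ h => ⟨compl_above_le_below hf h, compl_below_le_above hf h⟩

theorem IsExtremallyDisconnected.extContinuous_eq (hL : IsExtremallyDisconnected L) :
    extContinuous L = extHausdorff L := by
  refine extContinuous_subset_extHausdorff.antisymm fun f hf r s h => ?_
  obtain ⟨t, hrt, hts⟩ := exists_between h
  rw [← top_le_iff, ← hL (f.below t)]
  refine sup_le_sup (hf r t hrt).2 (le_trans ?_ (hf t s hts).1)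
  rw [← compl_compl_compl (f.above t)]
  exact compl_le_compl (compl_le_compl (f.below_le_compl_above t))

theorem isExtremallyDisconnected_of_extContinuous_eq (h : extContinuous L = extHausdorff L) :
    IsExtremallyDisconnected L := by
  intro a
  obtain ⟨f, hu, hv⟩ := exists_of_gen (fun _ => aᶜ) (fun _ => aᶜᶜ)
    (fun _ _ _ => inf_compl_self _) (fun _ => ciSup_const.symm) (fun _ => ciSup_const.symm)
  have hf : f ∈ extHausdorff L := fun r s _ => by simp [hu, hv]
  rw [← h] at hf
  simpa [hu, hv] using hf 0 1 one_pos

/-- A function lies below the function generated by the scale `c` if its values `f(q, —)` lie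
below `c q`. -/
theorem le_of_above_le {f g : ExtPartialFun L} {c : ℚ → L} (hf : f ∈ extContinuous L)
    (hu : ∀ r, g.above r = ⨆ p : {p : ℚ // r < p}, c p)
    (hv : ∀ s, g.below s = ⨆ q : {q : ℚ // q < s}, (c q)ᶜ) (h : ∀ q, f.above q ≤ c q) :
    f ≤ g := by
  refine ⟨fun r => ?_, fun s => ?_⟩
  · rw [hu, above_eq_iSup]
    exact iSup_mono fun p => h p
  · rw [hv]
    exact iSup_le fun q => (compl_le_compl (h q)).trans (compl_above_le_below hf q.2)

theorem IsExtremallyDisconnected.exists_isLUB (hL : IsExtremallyDisconnected L)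
    (S : Set (extContinuous L)) : ∃ a, IsLUB S a := by
  let A : ℚ → L := fun r => ⨆ f ∈ S, f.1.above r
  have hA {f : extContinuous L} (hf : f ∈ S) (r : ℚ) : f.1.above r ≤ A r :=
    le_iSup₂_of_le f hf le_rfl
  have hA' : Antitone A := fun p q h => iSup₂_mono fun f _ => f.1.antitone_above h
  have hc : IsScale fun r => (A r)ᶜᶜ := fun p q h => by
    rw [RatherBelow, compl_compl_compl, ← top_le_iff, ← hL (A q)]
    exact sup_le_sup_left (compl_le_compl (compl_le_compl (hA' h.le))) _
  obtain ⟨g, hg, hu, hv⟩ := hc.exists_extContinuous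
  refine ⟨⟨g, hg⟩, fun f hf => ?_, fun k hk => ⟨fun r => ?_, fun s => ?_⟩⟩
  · exact le_of_above_le f.2 hu hv fun q => (hA hf q).trans le_compl_compl
  · have hk' (p : ℚ) : A p ≤ k.1.above p := iSup₂_le fun f hf => (hk hf).1 p
    rw [hu]
    refine iSup_le fun p => le_trans ?_ (compl_below_le_above k.2 p.2)
    exact compl_le_compl ((k.1.below_le_compl_above p).trans (compl_le_compl (hk' p)))
  · have hk' (p : ℚ) : A p ≤ k.1.above p := iSup₂_le fun f hf => (hk hf).1 p
    rw [hv, below_eq_iSup]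
    refine iSup_mono fun q => ?_
    rw [compl_compl_compl]
    exact (k.1.below_le_compl_above q).trans (compl_le_compl (hk' q))

theorem IsExtremallyDisconnected.isCompletePoset (hL : IsExtremallyDisconnected L) :
    IsCompletePoset (extContinuous L) := fun S => by
  refine ⟨hL.exists_isLUB S, ?_⟩
  obtain ⟨b, hb⟩ := hL.exists_isLUB (lowerBounds S)
  exact ⟨b, isLUB_lowerBounds.1 hb⟩

/-- The extension of a family on `[0, 1]` by `⊤` on the negative rationals and by `⊥` beyond `1`. -/
def extendUnit (c : Set.Icc (0 : ℚ) 1 → L) (p : ℚ) : L :=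
  if h₀ : p < 0 then ⊤ else if h₁ : 1 < p then ⊥ else c ⟨p, not_lt.1 h₀, not_lt.1 h₁⟩

theorem extendUnit_of_neg (c : Set.Icc (0 : ℚ) 1 → L) {p : ℚ} (h : p < 0) :
    extendUnit c p = ⊤ := dif_pos h

theorem extendUnit_of_one_lt (c : Set.Icc (0 : ℚ) 1 → L) {p : ℚ} (h : 1 < p) :
    extendUnit c p = ⊥ := by
  rw [extendUnit, dif_neg (zero_lt_one.trans h).not_gt, dif_pos h]

theorem extendUnit_coe (c : Set.Icc (0 : ℚ) 1 → L) (p : Set.Icc (0 : ℚ) 1) :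
    extendUnit c p = c p := by
  rw [extendUnit, dif_neg p.2.1.not_gt, dif_neg p.2.2.not_gt]

theorem isScale_extendUnit {c : Set.Icc (0 : ℚ) 1 → L}
    (hc : ∀ r s, r < s → RatherBelow (c s) (c r)) : IsScale (extendUnit c) := by
  intro p q h
  rcases lt_or_ge p 0 with hp | hp
  · rw [RatherBelow, extendUnit_of_neg c hp, sup_top_eq]
  rcases lt_or_ge 1 q with hq | hq
  · rw [RatherBelow, extendUnit_of_one_lt c hq, compl_bot, top_sup_eq]
  have := hc ⟨p, hp, h.le.trans hq⟩ ⟨q, hp.trans h.le, hq⟩ h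
  rwa [← extendUnit_coe c, ← extendUnit_coe c] at this

theorem isExtremallyDisconnected_of_isCompletePoset (hL : IsCompletelyRegular L)
    (h : IsCompletePoset (extContinuous L)) : IsExtremallyDisconnected L := by
  intro a
  obtain ⟨k, hk⟩ := (h {f | f.1.above 0 ≤ a ∧ f.1.above 1 = ⊥}).1
  have hak : a ≤ k.1.above (1 / 2) := by
    conv_lhs => rw [hL a]
    refine sSup_le ?_
    rintro b ⟨c, hbc, hca, hc⟩
    let σ : Set.Icc (0 : ℚ) 1 → Set.Icc (0 : ℚ) 1 := fun p =>
      ⟨1 - p, sub_nonneg.2 p.2.2, sub_le_self _ p.2.1⟩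
    have hσ₀ : σ 0 = 1 := Subtype.ext (sub_zero 1)
    have hσ₁ : σ 1 = 0 := Subtype.ext (sub_self 1)
    have hd : IsScale (extendUnit (c ∘ σ)) :=
      isScale_extendUnit fun r s hrs => hc _ _ (sub_lt_sub_left (α := ℚ) hrs 1)
    have hd₀ : extendUnit (c ∘ σ) 0 = c 1 := by
      rw [← hσ₀]
      exact extendUnit_coe (c ∘ σ) 0
    have hd₁ : extendUnit (c ∘ σ) 1 = c 0 := by
      rw [← hσ₁]
      exact extendUnit_coe (c ∘ σ) 1
    obtain ⟨f, hf, hu, -⟩ := hd.exists_extContinuous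
    have hfS : f.above 0 ≤ a ∧ f.above 1 = ⊥ := by
      refine ⟨?_, ?_⟩
      · rw [hu]
        exact iSup_le fun p => (hd.antitone p.2.le).trans (hd₀.le.trans hca)
      · rw [hu, iSup_eq_bot]
        exact fun p => extendUnit_of_one_lt _ p.2
    refine le_trans ?_ ((hk.1 (show (⟨f, hf⟩ : extContinuous L) ∈ _ from hfS)).1 (1 / 2))
    change b ≤ f.above (1 / 2)
    rw [hu]
    exact le_iSup_of_le ⟨1, by norm_num⟩ (hbc.trans hd₁.ge)
  have hka : k.1.above 0 ≤ aᶜᶜ := by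
    rw [le_compl_iff_disjoint_right, hL aᶜ, disjoint_sSup_iff]
    rintro b ⟨c, hbc, hca, hc⟩
    have hcm : Monotone c := monotone_iff_forall_lt.2 fun p q hpq => (hc p q hpq).le
    have he : IsScale (extendUnit fun p => (c p)ᶜ) :=
      isScale_extendUnit fun r s hrs => (hc r s hrs).compl
    obtain ⟨g, hg, hu, hv⟩ := he.exists_extContinuous
    have hkg : k ≤ ⟨g, hg⟩ := by
      refine hk.2 fun f hf => le_of_above_le f.2 hu hv fun q => ?_
      rcases lt_or_ge q 0 with hq₀ | hq₀
      · rw [extendUnit_of_neg _ hq₀]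
        exact le_top
      rcases lt_or_ge 1 q with hq₁ | hq₁
      · exact (f.1.antitone_above hq₁.le).trans (hf.2.le.trans bot_le)
      · refine ((f.1.antitone_above hq₀).trans hf.1).trans ?_
        rw [show q = ((⟨q, hq₀, hq₁⟩ : Set.Icc (0 : ℚ) 1) : ℚ) from rfl, extendUnit_coe]
        exact le_compl_compl.trans (compl_le_compl ((hcm (show _ ≤ (1 : Set.Icc (0 : ℚ) 1) from hq₁)).trans hca))
    rw [← le_compl_iff_disjoint_right]
    refine (hkg.1 0).trans ?_
    change g.above 0 ≤ bᶜ
    rw [hu]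
    refine iSup_le fun p => (he.antitone p.2.le).trans ?_
    exact (extendUnit_coe (fun p => (c p)ᶜ) 0).le.trans (compl_le_compl hbc)
  have hk' : k.1.below (1 / 2) ≤ aᶜ :=
    (k.1.below_le_compl_above _).trans (compl_le_compl hak)
  rw [← top_le_iff, ← k.2 0 (1 / 2) (by norm_num), sup_comm]
  exact sup_le_sup hk' hka

end PointfreeReals

open PointfreeReals in
theorem mainTheorem9 (L : Type*) [Order.Frame L] (hL : IsCompletelyRegular L) :
    List.TFAE [
      IsExtremallyDisconnected L,
      extContinuous L = extHausdorff L,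
      IsCompletePoset (extContinuous L)] := by
  tfae_have 1 → 2 := IsExtremallyDisconnected.extContinuous_eq
  tfae_have 2 → 1 := isExtremallyDisconnected_of_extContinuous_eq
  tfae_have 1 → 3 := IsExtremallyDisconnected.isCompletePoset
  tfae_have 3 → 1 := isExtremallyDisconnected_of_isCompletePoset hL
  tfae_finish
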